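/- For an integer $t\ge 3$ let $P_t^+$ be the graph obtained from the path $v_1v_2\cdots v_t$ on $t$ vertices by adding the edge $v_1v_3$ (so that $v_1v_2v_3$ is a triangle). For graphs $G$ and $H$ let $R(G,H)$ be the least number $n$ such that every coloring of the edges of the complete graph $K_n$ with the colors red and blue contains a red copy of $G$ or a blue copy of $H$ (as a not necessarily induced subgraph). Then for every integer $t\ge 4$, $$R(P_t^+,P_t^+)=2t-1.$$ -/

import Mathlib

/-- The graph `P_t^+` on the vertices `0, 1, …, t - 1`: the path `0 - 1 - ⋯ - (t - 1)` together with
the extra edge `0 - 2` joining an end of the path to the vertex at distance two from it. -/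
def pathPlus (t : ℕ) : SimpleGraph (Fin t) :=
  SimpleGraph.fromRel fun i j => i.val + 1 = j.val ∨ (i.val = 0 ∧ j.val = 2)

/-- Every red-blue coloring of the edges of the complete graph on `n` vertices contains a red copy
of `G` or a blue copy of `H`. A coloring is given by its red graph `R`; its blue graph is the
complement `Rᶜ`. A copy is a not necessarily induced subgraph. -/
def RamseyArrows (n : ℕ) {V W : Type*} (G : SimpleGraph V) (H : SimpleGraph W) : Prop :=
  ∀ R : SimpleGraph (Fin n), G.IsContained R ∨ H.IsContained Rᶜ

/-- `r` is the 2-color Ramsey number `R(G, H)`: the least `n` such that every red-blue coloring of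
the complete graph on `n` vertices contains a red copy of `G` or a blue copy of `H`. -/
def IsRamseyNumber {V W : Type*} (G : SimpleGraph V) (H : SimpleGraph W) (r : ℕ) : Prop :=
  IsLeast {n : ℕ | RamseyArrows n G H} r

/-! For the lower bound, two disjoint red cliques with at most t - 1 vertices each leave a bipartite
blue graph.

For the upper bound, fix 2t - 1 vertices and lengthen a monochromatic P_k^+ step by step from k = 3,
where R(K_3, K_3) = 6 applies. Suppose a red P_k^+ cannot be lengthened in either color. Its last
vertex is then blue to a set X of k + 1 outside vertices. If no red component of X exceeds half of
X, blue contains a multipartite graph with a Hamiltonian path on X, which the last vertex dominates.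

Otherwise let D be a large red component and W the part of the tail after its last red neighbor of
D. Then Z = W ∪ (X \ D) is completely blue to D, and rerouting the tail into D bounds certain red
paths in D by |W|. Unless D is a red clique, a blue edge inside D gives a blue P_{k+1}^+ when Z is
large; when Z is small, depth-first search in D yields a blue tripartite graph
(`exists_balanced_separation`, `HasPathPlus.of_tripartite`). -/

/-- `G` contains a triangle together with a path that starts at one of its vertices and avoids the
other two, with at least `k` vertices in total. -/
def HasPathPlus {V : Type*} (G : SimpleGraph V) (k : ℕ) : Prop :=
  ∃ (a b c : V) (l : List V), G.Adj a b ∧ G.Adj a c ∧ G.Adj b c ∧ List.IsChain G.Adj (c :: l) ∧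
    (a :: b :: c :: l).Nodup ∧ k ≤ l.length + 3

theorem HasPathPlus.pathPlus_isContained {V : Type*} {G : SimpleGraph V} {t : ℕ}
    (h : HasPathPlus G t) : (pathPlus t).IsContained G := by
  obtain ⟨a, b, c, l, hab, hac, hbc, hch, hnd, hlen⟩ := h
  set L := a :: b :: c :: l with hL
  have hLlen : L.length = l.length + 3 := by simp [hL]
  have hchain : List.IsChain G.Adj L := by
    simp only [hL, List.isChain_cons_cons]
    exact ⟨hab, hbc, hch⟩
  rw [List.isChain_iff_getElem] at hchain
  let f : Fin t → V := fun i => L[i.val]'(by omega)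
  have key : ∀ i j : Fin t, (i.val + 1 = j.val ∨ (i.val = 0 ∧ j.val = 2)) → G.Adj (f i) (f j) := by
    rintro ⟨i, hi⟩ ⟨j, hj⟩ (h | ⟨h0, h2⟩)
    · simp only at h
      subst h
      exact hchain i (by omega)
    · simp only at h0 h2
      subst h0 h2
      exact hac
  refine ⟨⟨⟨f, ?_⟩, ?_⟩⟩
  · intro i j hij
    rw [pathPlus, SimpleGraph.fromRel_adj] at hij
    rcases hij.2 with h | h
    · exact key i j h
    · exact (key j i h).symm
  · intro i j hij
    have := (List.Nodup.getElem_inj_iff hnd).1 hij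
    exact Fin.ext this

/-- Both sides of the cut at t - 1 have at most t - 1 vertices. A connected red graph stays on one
side, and blue, being bipartite, has no triangle. -/
theorem not_ramseyArrows_pathPlus {t n : ℕ} (ht : 3 ≤ t) (hn : n < 2 * t - 1) :
    ¬ RamseyArrows n (pathPlus t) (pathPlus t) := by
  intro h
  let R : SimpleGraph (Fin n) :=
    { Adj := fun u v => u ≠ v ∧ (u.val < t - 1 ↔ v.val < t - 1)
      symm := ⟨fun u v h => ⟨h.1.symm, h.2.symm⟩⟩
      loopless := ⟨fun u h => h.1 rfl⟩ }
  rcases h R with ⟨⟨φ⟩⟩ | ⟨⟨φ⟩⟩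
  · have hside : ∀ i (hi : i < t), ((φ ⟨i, hi⟩).val < t - 1 ↔ (φ ⟨0, by omega⟩).val < t - 1) := by
      intro i
      induction i with
      | zero => intro hi; rfl
      | succ i ih =>
        intro hi
        have hadj : (pathPlus t).Adj ⟨i, by omega⟩ ⟨i + 1, hi⟩ := by
          rw [pathPlus, SimpleGraph.fromRel_adj]
          exact ⟨by simp, Or.inl (Or.inl rfl)⟩
        have h2 : R.Adj _ _ := φ.toHom.map_adj hadj
        exact h2.2.symm.trans (ih _)
    have hinj : Function.Injective fun i : Fin t => (φ i).val :=
      fun i j hij => φ.injective (Fin.ext hij)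
    by_cases h0 : (φ ⟨0, by omega⟩).val < t - 1
    · have := Finset.card_le_card_of_injOn (s := Finset.univ) (t := Finset.range (t - 1))
        (fun i : Fin t => (φ i).val)
        (fun i _ => by simpa using (hside i.val i.2).2 h0) hinj.injOn
      simp at this
      omega
    · have := Finset.card_le_card_of_injOn (s := Finset.univ) (t := Finset.Ico (t - 1) n)
        (fun i : Fin t => (φ i).val)
        (fun i _ => by
          have := (hside i.val i.2).not.2 h0
          simp only [Finset.coe_Ico, Set.mem_Ico]
          exact ⟨by simpa using this, (φ i).2⟩) hinj.injOn
      simp at this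
      omega
  · have hadj : ∀ i j : Fin t, (i.val + 1 = j.val ∨ (i.val = 0 ∧ j.val = 2)) →
        ¬ ((φ i).val < t - 1 ↔ (φ j).val < t - 1) := by
      intro i j hij hiff
      have hadj : (pathPlus t).Adj i j := by
        rw [pathPlus, SimpleGraph.fromRel_adj]
        refine ⟨fun h => ?_, Or.inl hij⟩
        rw [h] at hij
        omega
      have h2 : Rᶜ.Adj (φ i) (φ j) := φ.toHom.map_adj hadj
      rw [SimpleGraph.compl_adj] at h2
      exact h2.2 ⟨h2.1, hiff⟩
    have h01 := hadj ⟨0, by omega⟩ ⟨1, by omega⟩ (by simp)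
    have h12 := hadj ⟨1, by omega⟩ ⟨2, by omega⟩ (by simp)
    have h02 := hadj ⟨0, by omega⟩ ⟨2, by omega⟩ (by simp)
    tauto

/-! ### Paths in dense bipartite and multipartite graphs, and depth-first search -/

section Paths

variable {V : Type*} [DecidableEq V] {G : SimpleGraph V}

theorem exists_alternating_path (n : ℕ) {A B : Finset V} (hAB : ∀ x ∈ A, ∀ y ∈ B, G.Adj x y)
    (hA : n + 1 ≤ 2 * A.card) (hB : n ≤ 2 * B.card) {a : V} (ha : a ∈ A) :
    ∃ l : List V, List.IsChain G.Adj (a :: l) ∧ (a :: l).Nodup ∧ l.length = n ∧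
      ∀ x ∈ l, x ∈ A ∨ x ∈ B := by
  induction n generalizing A B a with
  | zero => exact ⟨[], by simp, by simp, rfl, by simp⟩
  | succ n ih =>
    obtain ⟨b, hb⟩ : B.Nonempty := Finset.card_pos.1 (by omega)
    have hcard := Finset.card_erase_of_mem ha
    obtain ⟨l, hch, hnd, hlen, hmem⟩ := ih (A := B) (B := A.erase a)
      (fun x hx y hy => (hAB y (Finset.mem_of_mem_erase hy) x hx).symm) (by omega) (by omega) hb
    have haB : a ∉ B := fun h => (hAB a ha a h).ne rfl
    refine ⟨b :: l, List.isChain_cons_cons.2 ⟨hAB a ha b hb, hch⟩, ?_, by simp [hlen], ?_⟩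
    · refine List.nodup_cons.2 ⟨?_, hnd⟩
      rintro hmem'
      rcases List.mem_cons.1 hmem' with rfl | h
      · exact haB hb
      · rcases hmem a h with h | h
        · exact haB h
        · simp at h
    · intro x hx
      rcases List.mem_cons.1 hx with rfl | h
      · exact Or.inr hb
      · rcases hmem x h with h | h
        · exact Or.inr h
        · exact Or.inl (Finset.mem_of_mem_erase h)

/-- The path offers |Y| + 1 slots, one after each of its vertices; distinct vertices of `Z` go into
the first `j` of them. -/
theorem exists_interleaved_path (j : ℕ) {Y : List V} {y : V} {Z : Finset V}
    (hch : List.IsChain G.Adj (y :: Y)) (hnd : (y :: Y).Nodup)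
    (hYZ : ∀ x ∈ y :: Y, ∀ z ∈ Z, G.Adj x z) (hj : j ≤ Y.length + 1) (hZ : j ≤ Z.card) :
    ∃ l : List V, List.IsChain G.Adj (y :: l) ∧ (y :: l).Nodup ∧ l.length = Y.length + j ∧
      ∀ x ∈ l, x ∈ Y ∨ x ∈ Z := by
  induction Y generalizing y Z j with
  | nil =>
    rcases Nat.eq_zero_or_pos j with rfl | hj0
    · exact ⟨[], by simp, by simp, rfl, by simp⟩
    · obtain ⟨z, hz⟩ : Z.Nonempty := Finset.card_pos.1 (by omega)
      have h := hYZ y (by simp) z hz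
      refine ⟨[z], by simpa using h, by simpa using h.ne, ?_, by simpa using hz⟩
      simp at hj ⊢
      omega
  | cons y' Y ih =>
    rcases Nat.eq_zero_or_pos j with rfl | hj0
    · exact ⟨y' :: Y, hch, hnd, rfl, fun x hx => Or.inl hx⟩
    · obtain ⟨z, hz⟩ : Z.Nonempty := Finset.card_pos.1 (by omega)
      have hcard := Finset.card_erase_of_mem hz
      obtain ⟨l, hch', hnd', hlen, hmem⟩ := ih (j - 1) (y := y') (Z := Z.erase z)
        (List.isChain_cons_cons.1 hch).2 (List.nodup_cons.1 hnd).2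
        (fun x hx w hw => hYZ x (List.mem_cons_of_mem _ hx) w (Finset.mem_of_mem_erase hw))
        (by simp at hj; omega) (by omega)
      have hyZ : ∀ w ∈ Z, w ∉ y :: y' :: Y := fun w hw h => (hYZ w h w hw).ne rfl
      have hmem' : ∀ x ∈ y' :: l, x ∈ y' :: Y ∨ x ∈ Z.erase z := by
        intro x hx
        rcases List.mem_cons.1 hx with rfl | h
        · simp
        · rcases hmem x h with h | h
          · exact Or.inl (List.mem_cons_of_mem _ h)
          · exact Or.inr h
      refine ⟨z :: y' :: l, ?_, ?_, ?_, ?_⟩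
      · exact List.isChain_cons_cons.2 ⟨hYZ y (by simp) z hz,
          List.isChain_cons_cons.2 ⟨(hYZ y' (by simp) z hz).symm, hch'⟩⟩
      · refine List.nodup_cons.2 ⟨fun h => ?_, List.nodup_cons.2 ⟨fun h => ?_, hnd'⟩⟩
        · rcases List.mem_cons.1 h with rfl | h
          · exact hyZ y hz (by simp)
          · rcases hmem' y h with h | h
            · exact (List.nodup_cons.1 hnd).1 h
            · exact hyZ y (Finset.mem_of_mem_erase h) (by simp)
        · rcases hmem' z h with h | h
          · exact hyZ z hz (List.mem_cons_of_mem _ h)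
          · simp at h
      · simp [hlen]
        omega
      · intro x hx
        rcases List.mem_cons.1 hx with rfl | h
        · exact Or.inr hz
        · rcases hmem' x h with h | h
          · exact Or.inl h
          · exact Or.inr (Finset.mem_of_mem_erase h)

/-- Depth-first search: if a connected set `D` has no path with more than `m` vertices ending at
`x`, then all but `m` of its vertices split into two parts of equal size with no edge between. -/
theorem exists_balanced_separation {D : Finset V} {x : V} {m : ℕ} (hx : x ∈ D)
    (hconn : ∀ S ⊆ D, x ∈ S → (∀ u ∈ S, ∀ v ∈ D, v ∉ S → ¬ G.Adj u v) → S = D)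
    (hpath : ∀ Q : List V, List.IsChain G.Adj Q → Q.Nodup → (∀ y ∈ Q, y ∈ D) →
      Q.getLast? = some x → Q.length ≤ m) :
    ∃ S U : Finset V, S ⊆ D ∧ U ⊆ D ∧ Disjoint S U ∧ S.card = U.card ∧
      (∀ u ∈ S, ∀ v ∈ U, ¬ G.Adj u v) ∧ D.card ≤ 2 * S.card + m := by
  -- `S` holds the finished vertices, `U` the unvisited ones and `Q` the stack, with its top at the
  -- head and `x` at the bottom. Each move lowers `e` = |U| - |S| by one, so the search halts with
  -- equal sizes.
  have key : ∀ (e : ℕ) (S U : Finset V) (Q : List V), U.card = S.card + e → S ⊆ D → U ⊆ D →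
      Disjoint S U → (∀ u ∈ S, ∀ v ∈ U, ¬ G.Adj u v) → List.IsChain G.Adj Q → Q.Nodup →
      (∀ y ∈ Q, y ∈ D ∧ y ∉ S ∧ y ∉ U) → (∀ y ∈ D, y ∈ S ∨ y ∈ U ∨ y ∈ Q) →
      Q.getLast? = some x →
      ∃ S U : Finset V, S ⊆ D ∧ U ⊆ D ∧ Disjoint S U ∧ S.card = U.card ∧
        (∀ u ∈ S, ∀ v ∈ U, ¬ G.Adj u v) ∧ D.card ≤ 2 * S.card + m := by
    intro e
    induction e with
    | zero =>
      intro S U Q hcard hSD hUD hdisj hSU hch hnd hQ hcov hlast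
      refine ⟨S, U, hSD, hUD, hdisj, hcard.symm, hSU, ?_⟩
      have h1 : D ⊆ (S ∪ U) ∪ Q.toFinset := by
        intro y hy
        simp only [Finset.mem_union, List.mem_toFinset]
        have := hcov y hy
        tauto
      have h2 := Finset.card_le_card h1
      have h3 := Finset.card_union_le (S ∪ U) Q.toFinset
      have h4 := Finset.card_union_le S U
      have h5 := Q.toFinset_card_le
      have h6 := hpath Q hch hnd (fun y hy => (hQ y hy).1) hlast
      omega
    | succ e ih =>
      intro S U Q hcard hSD hUD hdisj hSU hch hnd hQ hcov hlast
      match Q with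
      | [] => simp at hlast
      | y :: Q' =>
        have hy := hQ y (by simp)
        by_cases hex : ∃ u ∈ U, G.Adj u y
        · obtain ⟨u, hu, huy⟩ := hex
          have huc := Finset.card_erase_of_mem hu
          have huS : u ∉ S := Finset.disjoint_right.1 hdisj hu
          refine ih S (U.erase u) (u :: y :: Q') (by omega) hSD
            ((Finset.erase_subset _ _).trans hUD) (hdisj.mono_right (Finset.erase_subset _ _))
            (fun a ha b hb => hSU a ha b (Finset.mem_of_mem_erase hb))
            (List.isChain_cons_cons.2 ⟨huy, hch⟩)
            (List.nodup_cons.2 ⟨fun h => (hQ u h).2.2 hu, hnd⟩) ?_ ?_ ?_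
          · intro w hw
            rcases List.mem_cons.1 hw with rfl | hw
            · exact ⟨hUD hu, huS, by simp⟩
            · exact ⟨(hQ w hw).1, (hQ w hw).2.1, fun h => (hQ w hw).2.2 (Finset.mem_of_mem_erase h)⟩
          · intro w hw
            by_cases hwu : w = u
            · exact Or.inr (Or.inr (by simp [hwu]))
            · rcases hcov w hw with h | h | h
              · exact Or.inl h
              · exact Or.inr (Or.inl (Finset.mem_erase.2 ⟨hwu, h⟩))
              · exact Or.inr (Or.inr (List.mem_cons_of_mem _ h))
          · simpa using hlast
        · push Not at hex
          have hSU' : ∀ a ∈ insert y S, ∀ b ∈ U, ¬ G.Adj a b := by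
            intro a ha b hb hab
            rcases Finset.mem_insert.1 ha with rfl | ha
            · exact hex b hb hab.symm
            · exact hSU a ha b hb hab
          have hSD' : insert y S ⊆ D := Finset.insert_subset hy.1 hSD
          match Q' with
          | [] =>
            -- The root cannot be finished while `U` is nonempty: `insert y S` would be closed in
            -- `D`, hence all of `D`.
            exfalso
            have hyx : y = x := by simpa using hlast
            have hS := hconn (insert y S) hSD' (by simp [hyx]) (by
              intro a ha b hb hbS
              rcases hcov b hb with h | h | h
              · exact absurd (Finset.mem_insert_of_mem h) hbS
              · exact hSU' a ha b h
              · simp only [List.mem_singleton] at h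
                exact absurd (by simp [h]) hbS)
            obtain ⟨u, hu⟩ : U.Nonempty := Finset.card_pos.1 (by omega)
            have huS := hUD hu
            rw [← hS] at huS
            rcases Finset.mem_insert.1 huS with rfl | h
            · exact hy.2.2 hu
            · exact Finset.disjoint_left.1 hdisj h hu
          | q :: Q' =>
            have hc := Finset.card_insert_of_notMem hy.2.1
            refine ih (insert y S) U (q :: Q') (by omega) hSD' hUD
              (Finset.disjoint_insert_left.2 ⟨hy.2.2, hdisj⟩) hSU' (List.isChain_cons_cons.1 hch).2
              (List.nodup_cons.1 hnd).2 ?_ ?_ ?_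
            · intro w hw
              have h := hQ w (List.mem_cons_of_mem _ hw)
              refine ⟨h.1, fun hwi => ?_, h.2.2⟩
              rcases Finset.mem_insert.1 hwi with rfl | h'
              · exact (List.nodup_cons.1 hnd).1 hw
              · exact h.2.1 h'
            · intro w hw
              rcases hcov w hw with h | h | h
              · exact Or.inl (Finset.mem_insert_of_mem h)
              · exact Or.inr (Or.inl h)
              · rcases List.mem_cons.1 h with rfl | h
                · exact Or.inl (by simp)
                · exact Or.inr (Or.inr h)
            · simpa using hlast
  refine key (D.erase x).card ∅ (D.erase x) [x] (by simp) (by simp) (Finset.erase_subset _ _)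
    (by simp) (by simp) (by simp) (by simp) (by simpa using hx) ?_ (by simp)
  intro y hy
  by_cases h : y = x
  · simp [h]
  · simp [h, hy]

/-- A multipartite graph none of whose parts has more than half of the vertices has a
Hamiltonian path. -/
theorem exists_hamiltonian_path_of_fibers {ι : Type*} [LinearOrder ι] (X : Finset V) (f : V → ι)
    (hadj : ∀ u ∈ X, ∀ v ∈ X, f u ≠ f v → G.Adj u v)
    (hfib : ∀ x ∈ X, 2 * (X.filter fun y => f y = f x).card ≤ X.card) :
    ∃ l : List V, List.IsChain G.Adj l ∧ l.Nodup ∧ l.length = X.card ∧ ∀ x ∈ l, x ∈ X := by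
  set n := X.card with hn
  let e0 : Fin n ≃ X := X.equivFin.symm
  let σ := Tuple.sort fun i => f (e0 i)
  let c : Fin n → V := fun i => e0 (σ i)
  have hmono : Monotone fun i => f (c i) := Tuple.monotone_sort fun i => f (e0 i)
  have hcX : ∀ i, c i ∈ X := fun i => (e0 (σ i)).2
  have hcinj : Function.Injective c :=
    Subtype.val_injective.comp (e0.injective.comp σ.injective)
  -- In the order sorted by part, two positions at distance n / 2 or more in one part would force n
  -- / 2 + 1 vertices into it.
  have hfar : ∀ i j : Fin n, i.val + n / 2 ≤ j.val → G.Adj (c i) (c j) := by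
    intro i j hij
    refine hadj _ (hcX i) _ (hcX j) fun heq => ?_
    have h1 : (Finset.Icc i j).image c ⊆ X.filter fun y => f y = f (c i) := by
      intro y hy
      obtain ⟨p, hp, rfl⟩ := Finset.mem_image.1 hy
      rw [Finset.mem_Icc] at hp
      refine Finset.mem_filter.2 ⟨hcX p, le_antisymm ?_ (hmono hp.1)⟩
      exact heq ▸ hmono hp.2
    have h2 := Finset.card_le_card h1
    rw [Finset.card_image_of_injective _ hcinj, Fin.card_Icc] at h2
    have h3 := hfib (c i) (hcX i)
    omega
  -- The order n/2, 0, n/2 + 1, 1, … makes jumps of n/2 and n/2 + 1 only.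
  let g : Fin n → Fin n := fun p =>
    ⟨if p.val % 2 = 0 then n / 2 + p.val / 2 else p.val / 2, by have := p.2; split_ifs <;> omega⟩
  refine ⟨List.ofFn fun p => c (g p), ?_, ?_, by simp, ?_⟩
  · rw [List.isChain_iff_getElem]
    intro i hi
    simp only [List.length_ofFn] at hi
    simp only [List.getElem_ofFn]
    by_cases h : i % 2 = 0
    · refine (hfar _ _ ?_).symm
      simp only [g]
      split_ifs <;> omega
    · refine hfar _ _ ?_
      simp only [g]
      split_ifs <;> omega
  · rw [List.nodup_ofFn]
    refine hcinj.comp fun p q hpq => ?_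
    have hp := p.2
    have hq := q.2
    have := congrArg Fin.val hpq
    simp only [g] at this
    apply Fin.ext
    split_ifs at this <;> omega
  · intro x hx
    obtain ⟨p, rfl⟩ := (List.mem_ofFn' _ _).1 hx
    exact hcX _

end Paths

/-! ### Lengthening a monochromatic triangle with tail -/

section Step

variable {V : Type*} {R B : SimpleGraph V}

theorem HasPathPlus.mono {G : SimpleGraph V} {n m : ℕ} (hnm : n ≤ m) (h : HasPathPlus G m) :
    HasPathPlus G n := by
  obtain ⟨a, b, c, l, h1, h2, h3, h4, h5, h6⟩ := h
  exact ⟨a, b, c, l, h1, h2, h3, h4, h5, hnm.trans h6⟩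

theorem HasPathPlus.of_isClique {G : SimpleGraph V} {X : Finset V} (hX : G.IsClique (X : Set V))
    (h3 : 3 ≤ X.card) : HasPathPlus G X.card := by
  have hnd := X.nodup_toList
  have hlen := X.length_toList
  have hmem : ∀ x ∈ X.toList, x ∈ X := fun x hx => Finset.mem_toList.1 hx
  match hl : X.toList with
  | [] => simp [hl] at hlen; omega
  | [a] => simp [hl] at hlen; omega
  | [a, b] => simp [hl] at hlen; omega
  | a :: b :: c :: l =>
    rw [hl] at hnd hlen hmem
    have hpw : List.Pairwise G.Adj (a :: b :: c :: l) :=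
      List.Pairwise.imp_of_mem (fun hx hy hne => hX (hmem _ hx) (hmem _ hy) hne) hnd
    refine ⟨a, b, c, l, ?_, ?_, ?_, ?_, hnd, by simp at hlen; omega⟩
    · exact (List.pairwise_cons.1 hpw).1 b (by simp)
    · exact (List.pairwise_cons.1 hpw).1 c (by simp)
    · exact (List.pairwise_cons.1 (List.pairwise_cons.1 hpw).2).1 c (by simp)
    · exact (List.pairwise_cons.1 (List.pairwise_cons.1 hpw).2).2.isChain

/-- A path splits at its last vertex that has an `R`-neighbour in `D`; all later vertices are joined
to `D` by `B`. -/
theorem exists_split_of_path (hcol : ∀ u v, u ≠ v → R.Adj u v ∨ B.Adj u v) (D : Finset V)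
    (L : List V) (hLD : ∀ v ∈ L, v ∉ D) :
    (∀ v ∈ L, ∀ x ∈ D, B.Adj v x) ∨
      ∃ p v w, L = p ++ v :: w ∧ (∃ x ∈ D, R.Adj v x) ∧ ∀ u ∈ w, ∀ x ∈ D, B.Adj u x := by
  induction L with
  | nil => simp
  | cons y L ih =>
    rcases ih (fun v hv => hLD v (List.mem_cons_of_mem _ hv)) with h | ⟨p, v, w, rfl, hx, hw⟩
    · by_cases hy : ∃ x ∈ D, R.Adj y x
      · exact Or.inr ⟨[], y, L, rfl, hy, h⟩
      · push Not at hy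
        refine Or.inl fun v hv x hx => ?_
        rcases List.mem_cons.1 hv with rfl | hv
        · refine (hcol v x ?_).resolve_left (hy x hx)
          rintro rfl
          exact hLD v (by simp) hx
        · exact h v hv x hx
    · exact Or.inr ⟨y :: p, v, w, rfl, hx, hw⟩

/-- The tail may be left at any of its vertices along a path outside. -/
theorem HasPathPlus.of_append {a b c : V} {l p w Q : List V} {v x : V}
    (hab : R.Adj a b) (hac : R.Adj a c) (hbc : R.Adj b c) (hch : List.IsChain R.Adj (c :: l))
    (hnd : (a :: b :: c :: l).Nodup) (hl : c :: l = p ++ v :: w) (hvx : R.Adj v x)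
    (hQ : List.IsChain R.Adj (x :: Q)) (hQnd : (x :: Q).Nodup)
    (hdisj : ∀ y ∈ x :: Q, y ∉ a :: b :: c :: l) :
    HasPathPlus R (p.length + Q.length + 4) := by
  have hl' : ∃ l', c :: l' = p ++ v :: x :: Q := by
    cases p with
    | nil =>
      simp only [List.nil_append, List.cons.injEq] at hl
      exact ⟨x :: Q, by simp [hl.1]⟩
    | cons d p =>
      simp only [List.cons_append, List.cons.injEq] at hl
      exact ⟨p ++ v :: x :: Q, by simp [hl.1]⟩
  obtain ⟨l', hl'⟩ := hl'
  have hsub : (p ++ [v]).Sublist (c :: l) := by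
    rw [hl]
    exact List.Sublist.append_left (by simp) p
  have hpv : List.IsChain R.Adj (p ++ [v]) := by
    rw [hl, List.append_cons] at hch
    exact hch.left_of_append
  have heq : c :: l' = (p ++ [v]) ++ x :: Q := by rw [hl']; simp
  refine ⟨a, b, c, l', hab, hac, hbc, ?_, ?_, ?_⟩
  · rw [heq]
    refine List.isChain_append.2 ⟨hpv, hQ, ?_⟩
    intro y hy z hz
    simp at hy hz
    subst hy hz
    exact hvx
  · have hnd2 : ((a :: b :: (p ++ [v])) ++ x :: Q).Nodup := by
      have hs : (a :: b :: (p ++ [v])).Sublist (a :: b :: c :: l) := (hsub.cons_cons b).cons_cons a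
      refine List.nodup_append'.2 ⟨hnd.sublist hs, hQnd, ?_⟩
      intro y hy hy'
      exact hdisj y hy' (hs.subset hy)
    rw [heq]
    exact hnd2
  · have := congrArg List.length hl'
    simp at this
    omega

theorem HasPathPlus.of_dominated_path {G : SimpleGraph V} {v : V} {l : List V} {k : ℕ}
    (hch : List.IsChain G.Adj l) (hnd : l.Nodup) (hv : ∀ x ∈ l, G.Adj v x) (hk : 2 ≤ k)
    (hlen : k ≤ l.length) : HasPathPlus G (k + 1) := by
  match l with
  | [] => simp at hlen; omega
  | [x] => simp at hlen; omega
  | x :: y :: l =>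
    refine ⟨v, x, y, l, hv x (by simp), hv y (by simp), (List.isChain_cons_cons.1 hch).1,
      (List.isChain_cons_cons.1 hch).2, List.nodup_cons.2 ⟨fun h => (hv v h).ne rfl, hnd⟩, ?_⟩
    simp at hlen
    omega

variable [DecidableEq V]

/-- A complete bipartite graph together with an edge inside one part. -/
theorem HasPathPlus.of_bipartite {G : SimpleGraph V} {D Z : Finset V} {d e : V} {k : ℕ}
    (hDZ : ∀ x ∈ D, ∀ z ∈ Z, G.Adj x z) (hd : d ∈ D) (he : e ∈ D) (hde : G.Adj d e)
    (hk : 2 ≤ k) (hZ : k ≤ 2 * Z.card) (hD : k + 1 ≤ 2 * D.card) :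
    HasPathPlus G (k + 1) := by
  obtain ⟨z, hz⟩ : Z.Nonempty := Finset.card_pos.1 (by omega)
  have h1 := Finset.card_erase_of_mem hd
  have h2 := Finset.card_erase_of_mem hz
  have he' : e ∈ D.erase d := Finset.mem_erase.2 ⟨hde.ne.symm, he⟩
  -- `d` and `z` are kept for the triangle `d z e`; the tail leaves `e`, and 3 + (k - 2) = k + 1.
  obtain ⟨l, hch, hnd, hlen, hmem⟩ := exists_alternating_path (G := G) (k - 2) (A := D.erase d)
    (B := Z.erase z)
    (fun x hx y hy => hDZ x (Finset.mem_of_mem_erase hx) y (Finset.mem_of_mem_erase hy))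
    (by omega) (by omega) he'
  have hmem' : ∀ x ∈ e :: l, x ∈ D.erase d ∨ x ∈ Z.erase z := by
    intro x hx
    rcases List.mem_cons.1 hx with rfl | h
    · exact Or.inl he'
    · exact hmem x h
  have hDn : ∀ x ∈ D, x ∉ Z := fun x hx hx' => (hDZ x hx x hx').ne rfl
  have hdz := hDZ d hd z hz
  refine ⟨d, z, e, l, hdz, hde, (hDZ e he z hz).symm, hch,
    List.nodup_cons.2 ⟨fun h => ?_, List.nodup_cons.2 ⟨fun h => ?_, hnd⟩⟩, by omega⟩
  · rcases List.mem_cons.1 h with h | h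
    · exact hdz.ne h
    · rcases hmem' d h with h | h
      · simp at h
      · exact hDn d hd (Finset.mem_of_mem_erase h)
  · rcases hmem' z h with h | h
    · exact hDn z (Finset.mem_of_mem_erase h) hz
    · simp at h

/-- A path `s u …` alternates through all of `S` and `U`. One vertex of `Z` closes the triangle on
`s u`, and the others are interleaved after the 2|S| - 1 remaining path vertices, hence the bound on
|Z|. -/
theorem HasPathPlus.of_tripartite {G : SimpleGraph V} {S U Z : Finset V}
    (hSU : ∀ x ∈ S, ∀ y ∈ U, G.Adj x y) (hSZ : ∀ x ∈ S, ∀ z ∈ Z, G.Adj x z)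
    (hUZ : ∀ x ∈ U, ∀ z ∈ Z, G.Adj x z) (hcard : S.card = U.card) (hS : 0 < S.card)
    (hZ : 0 < Z.card) (hZS : Z.card ≤ 2 * S.card) : HasPathPlus G (2 * S.card + Z.card) := by
  obtain ⟨s, hs⟩ : S.Nonempty := Finset.card_pos.1 hS
  obtain ⟨z, hz⟩ : Z.Nonempty := Finset.card_pos.1 hZ
  obtain ⟨Y, hch, hnd, hlen, hmem⟩ := exists_alternating_path (2 * S.card - 1) hSU (by omega)
    (by omega) hs
  match Y with
  | [] => simp at hlen; omega
  | u :: Y =>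
    obtain ⟨hsu, hch⟩ := List.isChain_cons_cons.1 hch
    obtain ⟨hsn, hnd⟩ := List.nodup_cons.1 hnd
    have hYZ : ∀ x ∈ u :: Y, ∀ w ∈ Z, G.Adj x w := by
      intro x hx w hw
      rcases hmem x hx with h | h
      · exact hSZ x h w hw
      · exact hUZ x h w hw
    have h1 := Finset.card_erase_of_mem hz
    simp only [List.length_cons] at hlen
    obtain ⟨l, hch', hnd', hlen', hmem'⟩ := exists_interleaved_path (Z.card - 1) (Z := Z.erase z)
      hch hnd (fun x hx w hw => hYZ x hx w (Finset.mem_of_mem_erase hw)) (by omega) (by omega)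
    have hl : ∀ x ∈ u :: l, x ∈ u :: Y ∨ x ∈ Z.erase z := by
      intro x hx
      rcases List.mem_cons.1 hx with rfl | h
      · simp
      · rcases hmem' x h with h | h
        · exact Or.inl (List.mem_cons_of_mem _ h)
        · exact Or.inr h
    have hsz := hSZ s hs z hz
    refine ⟨s, z, u, l, hsz, hsu, (hYZ u (by simp) z hz).symm, hch',
      List.nodup_cons.2 ⟨fun h => ?_, List.nodup_cons.2 ⟨fun h => ?_, hnd'⟩⟩, by omega⟩
    · rcases List.mem_cons.1 h with h | h
      · exact hsz.ne h
      · rcases hl s h with h | h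
        · exact hsn h
        · exact (hSZ s hs s (Finset.mem_of_mem_erase h)).ne rfl
    · rcases hl z h with h | h
      · exact (hYZ z h z hz).ne rfl
      · simp at h

/-- The induction step when some component of `R` restricted to `X` has more than half of the
vertices of `X`. -/
theorem hasPathPlus_succ_of_large_component {k : ℕ} (hk : 3 ≤ k)
    (hcol : ∀ u v, u ≠ v → R.Adj u v ∨ B.Adj u v) {a b c : V} {l : List V}
    (hab : R.Adj a b) (hac : R.Adj a c) (hbc : R.Adj b c) (hch : List.IsChain R.Adj (c :: l))
    (hnd : (a :: b :: c :: l).Nodup) (hlen : l.length + 3 = k)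
    {X D : Finset V} (hXP : ∀ x ∈ X, x ∉ a :: b :: c :: l) (hX : X.card = k + 1) (hDX : D ⊆ X)
    (hDlarge : k + 2 ≤ 2 * D.card)
    (hlast : ∀ x ∈ X, B.Adj ((c :: l).getLast (by simp)) x)
    (hDclosed : ∀ u ∈ D, ∀ v ∈ X \ D, B.Adj u v)
    (hDconn : ∀ x ∈ D, ∀ S ⊆ D, x ∈ S → (∀ u ∈ S, ∀ v ∈ D, v ∉ S → ¬ R.Adj u v) → S = D) :
    HasPathPlus R (k + 1) ∨ HasPathPlus B (k + 1) := by
  by_contra! hno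
  obtain ⟨hR, hB⟩ := hno
  -- `W` is the tail beyond its last vertex with a red neighbor `x` in `D`, or all of `c :: l` if
  -- there is none. In the first case a red path in `D` ending at `x` with more than |W| vertices
  -- would replace `W` and lengthen the red graph.
  obtain ⟨x, hx, W, hWlast, hWsub, hWD, hWpath⟩ : ∃ x ∈ D, ∃ W : Finset V,
      (c :: l).getLast (by simp) ∈ W ∧ (∀ w ∈ W, w ∈ c :: l) ∧ (∀ w ∈ W, ∀ d ∈ D, B.Adj w d) ∧
      (k ≤ W.card + 2 ∨ ∀ Q : List V, List.IsChain R.Adj Q → Q.Nodup → (∀ y ∈ Q, y ∈ D) →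
        Q.getLast? = some x → Q.length ≤ W.card) := by
    have hndl : (c :: l).Nodup := (List.nodup_cons.1 (List.nodup_cons.1 hnd).2).2
    rcases exists_split_of_path hcol D (c :: l) (fun v hv hvD => hXP v (hDX hvD)
      (List.mem_cons_of_mem _ (List.mem_cons_of_mem _ hv))) with h | ⟨p, v, w, hpw, ⟨x, hx, hvx⟩, hw⟩
    · obtain ⟨x, hx⟩ : D.Nonempty := Finset.card_pos.1 (by omega)
      refine ⟨x, hx, (c :: l).toFinset,
        List.mem_toFinset.2 (List.getLast_mem _), fun w hw => List.mem_toFinset.1 hw,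
        fun w hw => h w (List.mem_toFinset.1 hw), Or.inl ?_⟩
      rw [List.toFinset_card_of_nodup hndl]
      simp
      omega
    · have hlen2 := congrArg List.length hpw
      simp only [List.length_cons, List.length_append] at hlen2
      rw [hpw] at hndl
      have hwnd : w.Nodup := (List.nodup_cons.1 hndl.of_append_right).2
      have hpath : ∀ Q : List V, List.IsChain R.Adj Q → Q.Nodup → (∀ y ∈ Q, y ∈ D) →
          Q.getLast? = some x → Q.length ≤ w.length := by
        intro Q hQ hQnd hQD hQx
        have hQr : Q.reverse.head? = some x := by simpa using hQx
        match hrev : Q.reverse with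
        | [] => simp [hrev] at hQr
        | y :: Q' =>
          rw [hrev] at hQr
          simp only [List.head?_cons, Option.some.injEq] at hQr
          subst hQr
          have hlenQ : Q.length = Q'.length + 1 := by rw [← List.length_reverse, hrev]; rfl
          by_contra! hlt
          refine hR (HasPathPlus.mono ?_ (HasPathPlus.of_append hab hac hbc hch hnd hpw hvx (Q := Q') ?_ ?_ ?_))
          · omega
          · rw [← hrev, List.isChain_reverse]
            exact hQ.imp fun _ _ h => h.symm
          · rw [← hrev, List.nodup_reverse]
            exact hQnd
          · intro z hz
            rw [← hrev, List.mem_reverse] at hz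
            exact hXP z (hDX (hQD z hz))
      have hw0 : w ≠ [] := by
        rintro rfl
        have := hpath [x] (by simp) (by simp) (by simpa using hx) (by simp)
        simp at this
      refine ⟨x, hx, w.toFinset, ?_, ?_, fun u hu => hw u (List.mem_toFinset.1 hu), Or.inr ?_⟩
      · simp only [hpw, List.mem_toFinset]
        rw [List.getLast_append_of_ne_nil _ (by simp), List.getLast_cons hw0]
        exact List.getLast_mem hw0
      · intro u hu
        rw [hpw]
        simp [List.mem_toFinset.1 hu]
      · rw [List.toFinset_card_of_nodup hwnd]
        exact hpath
  set t := (c :: l).getLast (by simp) with ht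
  have hWX : Disjoint W (X \ D) := by
    rw [Finset.disjoint_left]
    intro w hw hwX
    exact hXP w (Finset.mem_sdiff.1 hwX).1
      (List.mem_cons_of_mem _ (List.mem_cons_of_mem _ (hWsub w hw)))
  set Z := W ∪ (X \ D) with hZdef
  have hZcard : Z.card = W.card + (X \ D).card := Finset.card_union_of_disjoint hWX
  have hXD : (X \ D).card + D.card = k + 1 := by
    rw [← hX]
    exact Finset.card_sdiff_add_card_eq_card hDX
  have hW0 : 0 < W.card := Finset.card_pos.2 ⟨t, hWlast⟩
  have hDZ : ∀ d ∈ D, ∀ z ∈ Z, B.Adj d z := by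
    intro d hd z hz
    rcases Finset.mem_union.1 hz with h | h
    · exact (hWD z h d hd).symm
    · exact hDclosed d hd z h
  by_cases hclique : R.IsClique (D : Set V)
  · rcases (X \ D).eq_empty_or_nonempty with hemp | ⟨y, hy⟩
    · have hDeq : D.card = k + 1 := by rw [hemp] at hXD; simpa using hXD
      exact hR (hDeq ▸ HasPathPlus.of_isClique hclique (by omega))
    · have hXD0 : 0 < (X \ D).card := Finset.card_pos.2 ⟨y, hy⟩
      -- A red clique has a Hamiltonian path ending at `x`, so |D| ≤ |W| and |Z| ≥ |X|. With the
      -- whole tail in `W`, |Z| ≥ k - 1 suffices.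
      have hm : k + 1 ≤ 2 * Z.card := by
        rcases hWpath with h | h
        · omega
        · have hpw : List.Pairwise R.Adj ((D.erase x).toList ++ [x]) := by
            refine List.pairwise_append.2 ⟨?_, by simp, ?_⟩
            · refine List.Pairwise.imp_of_mem (fun ha hb hne => hclique ?_ ?_ hne)
                (D.erase x).nodup_toList
              · exact Finset.mem_of_mem_erase (Finset.mem_toList.1 ha)
              · exact Finset.mem_of_mem_erase (Finset.mem_toList.1 hb)
            · intro u hu v hv
              simp only [List.mem_singleton] at hv
              subst hv
              have := Finset.mem_erase.1 (Finset.mem_toList.1 hu)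
              exact hclique this.2 hx this.1
          have h2 := h _ hpw.isChain (hpw.imp fun h => h.ne) (by
            intro u hu
            by_cases hux : u = x
            · exact hux ▸ hx
            · simpa [hux] using hu) (by simp)
          have h3 := Finset.card_erase_of_mem hx
          simp at h2
          omega
      have hyZ : y ∈ Z := Finset.mem_union_right _ hy
      have htZ : t ∈ Z := Finset.mem_union_left _ hWlast
      have hty : B.Adj t y := hlast y (Finset.mem_sdiff.1 hy).1
      refine hB (HasPathPlus.of_bipartite (D := Z) (Z := D)
        (fun z hz d hd => (hDZ d hd z hz).symm) htZ hyZ hty (by omega) (by omega) hm)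
  · obtain ⟨d, hd, e, he, hne, hde⟩ : ∃ d ∈ D, ∃ e ∈ D, d ≠ e ∧ ¬ R.Adj d e := by
      simp only [SimpleGraph.IsClique, Set.Pairwise] at hclique
      push Not at hclique
      simpa using hclique
    have hdeB := (hcol d e hne).resolve_left hde
    by_cases hZ : k ≤ 2 * Z.card
    · exact hB (HasPathPlus.of_bipartite hDZ hd he hdeB (by omega) hZ (by omega))
    -- With the whole tail in `W`, 2|Z| < k leaves only k = 3, where a blue triangle `d e t` with
    -- pendant `f` is enough.
    · have hpath := hWpath.resolve_left fun hkW => by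
        have h1 := Finset.card_erase_of_mem hd
        have h2 := Finset.card_erase_of_mem (Finset.mem_erase.2 ⟨hne.symm, he⟩)
        obtain ⟨f, hf⟩ : ((D.erase d).erase e).Nonempty := Finset.card_pos.1 (by omega)
        simp only [Finset.mem_erase] at hf
        have hdt := (hWD t hWlast d hd).symm
        have het := (hWD t hWlast e he).symm
        have htf := hWD t hWlast f hf.2.2
        exact hB ⟨d, e, t, [f], hdeB, hdt, het, by simpa using htf,
          by simp [hne, hdt.ne, het.ne, htf.ne, hf.1.symm, hf.2.1.symm], by simp; omega⟩
      obtain ⟨S, U, hSD, hUD, hdisj, hcard, hSU, hcardD⟩ :=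
        exists_balanced_separation hx (hDconn x hx) hpath
      -- The count is 2|S| + |Z| ≥ |D| - |W| + |Z| = k + 1; with 2|Z| < k it also gives |Z| ≤ 2|S|.
      refine hB (HasPathPlus.mono ?_ (HasPathPlus.of_tripartite (S := S) (U := U) (Z := Z) ?_
        (fun s hs => hDZ s (hSD hs)) (fun u hu => hDZ u (hUD hu)) hcard ?_ ?_ ?_))
      · omega
      · intro s hs u hu
        refine (hcol s u ?_).resolve_left (hSU s hs u hu)
        rintro rfl
        exact Finset.disjoint_left.1 hdisj hs hu
      all_goals omega

end Step

/-! ### Induction on the number of vertices of the copy -/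

section Ramsey

variable {V : Type*} {R B : SimpleGraph V}

theorem hasPathPlus_three_of_adj {G : SimpleGraph V} {u v w : V} (huv : G.Adj u v)
    (huw : G.Adj u w) (hvw : G.Adj v w) : HasPathPlus G 3 :=
  ⟨u, v, w, [], huv, huw, hvw, by simp, by simp [huv.ne, huw.ne, hvw.ne], by simp⟩

theorem hasPathPlus_three_of_degree (hcol : ∀ u v, u ≠ v → R.Adj u v ∨ B.Adj u v) {v : V}
    {N : Finset V} (hN : ∀ x ∈ N, R.Adj v x) (hcard : 2 < N.card) :
    HasPathPlus R 3 ∨ HasPathPlus B 3 := by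
  obtain ⟨x, y, z, hx, hy, hz, hxy, hxz, hyz⟩ := Finset.two_lt_card_iff.1 hcard
  by_contra! hno
  have hB : ∀ u ∈ N, ∀ w ∈ N, u ≠ w → B.Adj u w := fun u hu w hw huw =>
    (hcol u w huw).resolve_left fun h =>
      hno.1 (hasPathPlus_three_of_adj (hN u hu) (hN w hw) h)
  exact hno.2 (hasPathPlus_three_of_adj (hB x hx y hy hxy) (hB x hx z hz hxz) (hB y hy z hz hyz))

variable [DecidableEq V]

theorem hasPathPlus_succ {k : ℕ} (hk : 3 ≤ k) [Fintype V] (hV : 2 * k + 1 ≤ Fintype.card V)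
    (hcol : ∀ u v, u ≠ v → R.Adj u v ∨ B.Adj u v) (h : HasPathPlus R k) :
    HasPathPlus R (k + 1) ∨ HasPathPlus B (k + 1) := by
  by_contra! hno
  obtain ⟨a, b, c, l, hab, hac, hbc, hch, hnd, hkl⟩ := h
  have hlen : l.length + 3 = k := by
    by_contra hne
    exact hno.1 ⟨a, b, c, l, hab, hac, hbc, hch, hnd, by omega⟩
  obtain ⟨X, hXsub, hX⟩ : ∃ X ⊆ (a :: b :: c :: l).toFinsetᶜ, X.card = k + 1 := by
    refine Finset.exists_subset_card_eq ?_
    rw [Finset.card_compl, List.toFinset_card_of_nodup hnd]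
    simp only [List.length_cons]
    omega
  have hXP : ∀ x ∈ X, x ∉ a :: b :: c :: l := fun x hx => by
    simpa only [Finset.mem_compl, List.mem_toFinset] using hXsub hx
  have hlast : ∀ x ∈ X, B.Adj ((c :: l).getLast (by simp)) x := by
    intro x hx
    refine (hcol _ x ?_).resolve_left fun hadj => hno.1 ?_
    · intro heq
      refine hXP x hx (List.mem_cons_of_mem _ (List.mem_cons_of_mem _ ?_))
      rw [← heq]
      exact List.getLast_mem _
    · have := HasPathPlus.of_append hab hac hbc hch hnd
        (p := (c :: l).dropLast) (w := []) (List.dropLast_append_getLast (by simp)).symm hadj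
        (Q := []) (by simp) (by simp) (by simpa using hXP x hx)
      refine this.mono ?_
      simp
      omega
  let H : SimpleGraph V :=
    { Adj := fun u v => R.Adj u v ∧ u ∈ X ∧ v ∈ X
      symm := ⟨fun u v h => ⟨h.1.symm, h.2.2, h.2.1⟩⟩
      loopless := ⟨fun u h => h.1.ne rfl⟩ }
  have hHB : ∀ u ∈ X, ∀ v ∈ X, ¬ H.Reachable u v → B.Adj u v := by
    intro u hu v hv huv
    refine (hcol u v ?_).resolve_left fun hadj => ?_
    · rintro rfl
      exact huv (SimpleGraph.Reachable.refl u)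
    · exact huv (SimpleGraph.Adj.reachable (G := H) ⟨hadj, hu, hv⟩)
  classical
  by_cases hbig : ∃ x ∈ X, k + 2 ≤ 2 * (X.filter fun y => H.Reachable x y).card
  · obtain ⟨x, hx, hD⟩ := hbig
    have hmem : ∀ y, y ∈ (X.filter fun y => H.Reachable x y) ↔ y ∈ X ∧ H.Reachable x y :=
      fun y => Finset.mem_filter
    set D := X.filter fun y => H.Reachable x y
    refine not_or.2 hno (hasPathPlus_succ_of_large_component hk hcol hab hac hbc hch hnd hlen hXP hX
      (Finset.filter_subset _ _) hD hlast ?_ ?_)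
    · intro u hu v hv
      rw [Finset.mem_sdiff] at hv
      have hu' := (hmem u).1 hu
      exact hHB u hu'.1 v hv.1 fun huv => hv.2 ((hmem v).2 ⟨hv.1, hu'.2.trans huv⟩)
    · intro y hy S hSD hyS hS
      refine hSD.antisymm fun z hz => ?_
      have hyz : H.Reachable y z := ((hmem y).1 hy).2.symm.trans ((hmem z).1 hz).2
      obtain ⟨p⟩ := hyz
      clear hy hz
      induction p with
      | nil => exact hyS
      | @cons u v w huv p ih =>
        refine ih ?_
        by_contra hvS
        have hu := (hmem u).1 (hSD hyS)
        exact hS u hyS v ((hmem v).2 ⟨huv.2.2, hu.2.trans (SimpleGraph.Adj.reachable huv)⟩) hvS huv.1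
  · push Not at hbig
    -- Numbering the components supplies the linear order by which the parts are sorted.
    let f : V → Fin (Fintype.card H.ConnectedComponent) := fun v =>
      Fintype.equivFin _ (H.connectedComponentMk v)
    have hf : ∀ u v, f u = f v ↔ H.Reachable u v := fun u v => by
      simp only [f, EmbeddingLike.apply_eq_iff_eq, SimpleGraph.ConnectedComponent.eq]
    obtain ⟨p, hp, hpnd, hplen, hpX⟩ := exists_hamiltonian_path_of_fibers (G := B) X f
      (fun u hu v hv huv => hHB u hu v hv ((hf u v).not.1 huv)) (by
        intro x hx
        have hfil : (X.filter fun y => f y = f x) = X.filter fun y => H.Reachable x y :=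
          Finset.filter_congr fun y _ => (hf y x).trans SimpleGraph.reachable_comm
        have := hbig x hx
        rw [hfil]
        omega)
    exact hno.2 (HasPathPlus.of_dominated_path hp hpnd (fun x hx => hlast x (hpX x hx)) (by omega)
      (by omega))

theorem hasPathPlus_three [Fintype V] (hV : 6 ≤ Fintype.card V)
    (hcol : ∀ u v, u ≠ v → R.Adj u v ∨ B.Adj u v) : HasPathPlus R 3 ∨ HasPathPlus B 3 := by
  classical
  obtain ⟨v⟩ : Nonempty V := Fintype.card_pos_iff.1 (by omega)
  have hcover : Finset.univ.erase v ⊆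
      Finset.univ.filter (R.Adj v) ∪ Finset.univ.filter (B.Adj v) := by
    intro x hx
    simpa using hcol v x (Finset.ne_of_mem_erase hx).symm
  have h1 := (Finset.card_le_card hcover).trans (Finset.card_union_le _ _)
  rw [Finset.card_erase_of_mem (Finset.mem_univ v), Finset.card_univ] at h1
  by_cases h : 2 < (Finset.univ.filter (R.Adj v)).card
  · exact hasPathPlus_three_of_degree hcol (fun x hx => (Finset.mem_filter.1 hx).2) h
  · exact (hasPathPlus_three_of_degree (N := Finset.univ.filter (B.Adj v))
      (fun x y hxy => (hcol x y hxy).symm) (fun x hx => (Finset.mem_filter.1 hx).2) (by omega)).symm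

theorem hasPathPlus_or_hasPathPlus [Fintype V] (hV : 6 ≤ Fintype.card V)
    (hcol : ∀ u v, u ≠ v → R.Adj u v ∨ B.Adj u v) {k : ℕ} (hk : 3 ≤ k)
    (hkV : 2 * k ≤ Fintype.card V + 1) : HasPathPlus R k ∨ HasPathPlus B k := by
  induction k, hk using Nat.le_induction with
  | base => exact hasPathPlus_three hV hcol
  | succ k hk ih =>
    rcases ih (by omega) with h | h
    · exact hasPathPlus_succ hk (by omega) hcol h
    · exact (hasPathPlus_succ hk (by omega) (fun x y hxy => (hcol x y hxy).symm) h).symm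

end Ramsey

theorem theorem4p1 (t : ℕ) (ht : 4 ≤ t) :
    IsRamseyNumber (pathPlus t) (pathPlus t) (2 * t - 1) := by
  refine ⟨fun R => ?_, fun n hn => ?_⟩
  · have hcol : ∀ u v, u ≠ v → R.Adj u v ∨ Rᶜ.Adj u v := fun u v huv => by
      rw [SimpleGraph.compl_adj]
      tauto
    have := hasPathPlus_or_hasPathPlus (V := Fin (2 * t - 1)) (k := t)
      (by rw [Fintype.card_fin]; omega) hcol (by omega) (by rw [Fintype.card_fin]; omega)
    exact this.imp HasPathPlus.pathPlus_isContained HasPathPlus.pathPlus_isContained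
  · by_contra hlt
    exact not_ramseyArrows_pathPlus (by omega) (not_le.1 hlt) hn
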